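/- For an integer $N\ge 2$ let $\varphi(N)$ be Euler's totient, let $r_1,\dots,r_{\varphi(N)}$ be the integers in $\{1,\dots,N\}$ coprime to $N$, and put $$C_N=N^{\varphi(N)}\prod_{p\mid N}p^{\varphi(N)/(p-1)},\qquad \mathbf B_N(m)=C_N^m\prod_{j=1}^{\varphi(N)}\frac{(r_j/N)_m}{m!},\qquad \mathbf H_N(m)=\sum_{j=1}^{\varphi(N)}H(r_j/N,m)-\varphi(N)H(1,m),$$ where $p$ runs over primes, $(\alpha)_m=\alpha(\alpha+1)\cdots(\alpha+m-1)$ with $(\alpha)_0=1$, and $H(x,m)=\sum_{n=0}^{m-1}\frac1{x+n}$. For $\mathbf N=(N_1,\dots,N_k)$ with all $N_j\ge2$ put $C_{\mathbf N}=\prod_j C_{N_j}$, $\Phi_{\mathbf N}=\sum_j\varphi(N_j)$, $M_{\mathbf N}=\max_j N_j$, $\mathbf B_{\mathbf N}(m)=\prod_j\mathbf B_{N_j}(m)$, $\mathbf H_{\mathbf N}(m)=\sum_j\mathbf H_{N_j}(m)$, and $$\mathbf F_{\mathbf N}(z)=\sum_{m\ge0}\mathbf B_{\mathbf N}(m)z^m,\qquad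 \mathbf G_{\mathbf N}(z)=\sum_{m\ge1}\mathbf H_{\mathbf N}(m)\mathbf B_{\mathbf N}(m)z^m,\qquad \mathbf q_{\mathbf N}(z)=z\exp\bigl(\mathbf G_{\mathbf N}(z)/\mathbf F_{\mathbf N}(z)\bigr).$$ Let $N_1,\dots,N_k\ge2$ be integers with $\Phi_{\mathbf N}\ge4$. Then the series $\mathbf F_{\mathbf N}(z)$ and $\mathbf G_{\mathbf N}(z)$ converge at $z=1/C_{\mathbf N}$, and $$\exp\bigl(-\pi\cot(\pi/M_{\mathbf N})\bigr)>\mathbf q_{\mathbf N}(1/C_{\mathbf N}).$$ -/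

import Mathlib

noncomputable section

namespace MirrorMap

/-- The integers in `{1, …, N}` that are coprime to `N`. -/
def residues (N : ℕ) : Finset ℕ := (Finset.Icc 1 N).filter fun r => Nat.Coprime r N

/-- `C_N = N ^ φ(N) * ∏_{p ∣ N} p ^ (φ(N) / (p - 1))`, the product being over primes; each
division in the exponent is exact. -/
def C₁ (N : ℕ) : ℕ :=
  N ^ Nat.totient N * ∏ p ∈ N.primeFactors, p ^ (Nat.totient N / (p - 1))

/-- `B_N(m) = C_N ^ m * ∏_r (r / N)_m / m!`, with `(α)_m` the rising factorial. -/
def B₁ (N m : ℕ) : ℝ :=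
  (C₁ N : ℝ) ^ m *
    ∏ r ∈ residues N, (ascPochhammer ℝ m).eval ((r : ℝ) / (N : ℝ)) / (Nat.factorial m : ℝ)

/-- `H(x, m) = ∑_{n=0}^{m-1} 1 / (x + n)`. -/
def harm (x : ℝ) (m : ℕ) : ℝ := ∑ n ∈ Finset.range m, 1 / (x + (n : ℝ))

/-- `H_N(m) = ∑_r H(r / N, m) - φ(N) H(1, m)`. -/
def H₁ (N m : ℕ) : ℝ :=
  (∑ r ∈ residues N, harm ((r : ℝ) / (N : ℝ)) m) - (Nat.totient N : ℝ) * harm 1 m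

variable {k : ℕ}

/-- `C_𝐍 = C_{N_1} ⋯ C_{N_k}`. -/
def C (N : Fin k → ℕ) : ℕ := ∏ j, C₁ (N j)

/-- `Φ_𝐍 = φ(N_1) + ⋯ + φ(N_k)`. -/
def Phi (N : Fin k → ℕ) : ℕ := ∑ j, Nat.totient (N j)

/-- `M_𝐍 = max(N_1, …, N_k)`. -/
def M (N : Fin k → ℕ) : ℕ := Finset.univ.sup N

/-- `B_𝐍(m) = ∏_j B_{N_j}(m)`. -/
def B (N : Fin k → ℕ) (m : ℕ) : ℝ := ∏ j, B₁ (N j) m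

/-- `H_𝐍(m) = ∑_j H_{N_j}(m)`. -/
def H (N : Fin k → ℕ) (m : ℕ) : ℝ := ∑ j, H₁ (N j) m

/-- `F_𝐍(z) = ∑_{m ≥ 0} B_𝐍(m) z ^ m`, for real `z`. -/
def F (N : Fin k → ℕ) (z : ℝ) : ℝ := ∑' m : ℕ, B N m * z ^ m

/-- `G_𝐍(z) = ∑_{m ≥ 1} H_𝐍(m) B_𝐍(m) z ^ m`, for real `z`; the term `m = 0` included here
vanishes, because `H_𝐍(0) = 0`. -/
def G (N : Fin k → ℕ) (z : ℝ) : ℝ := ∑' m : ℕ, H N m * B N m * z ^ m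

/-- The canonical coordinate `q_𝐍(z) = z * exp (G_𝐍(z) / F_𝐍(z))`, for real `z`. -/
def q (N : Fin k → ℕ) (z : ℝ) : ℝ := z * Real.exp (G N z / F N z)

end MirrorMap

end

namespace MirrorMap

open Filter Topology

/-! ### Coprime harmonic sums and the limit of `H_N(m)` -/

/-! At `z = 1/C` the claim compares `G/F - log C` with `-π cot(π/M)`. Since `t < tan t`, `π cot(π/M)
< M`, so `G/F ≤ log C - M` is enough.

Each `H_N(m)` increases from `0` to the limit `log C_N`, an asymptotic for harmonic sums over
integers coprime to `N` (`tendsto_H₁`). Hence `G ≤ log C * (F - 1)` (`tsum_H_mul_normB_le`), and it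
remains to see that `M * F ≤ log C`.

Pairing `r/N` with `1 - r/N` bounds the normalized coefficients by powers of `(1/2)_m / m!`; with `Φ
≥ 4` this gives `F ≤ 17/15` (`tsum_normB_le`). Estimates over the primes dividing `N` give `log C ≥
6/5 * M` (`six_fifths_mul_M_le_log_C`). Now `17/15 < 6/5` finishes. -/

/-- The sum of `1 / k` over `0 < k ≤ X` with `k` divisible by no element of `P`. -/
noncomputable def sievedHarmonic (P : Finset ℕ) (X : ℕ) : ℝ :=
  ∑ k ∈ (Finset.Ioc 0 X).filter (fun k => ∀ p ∈ P, ¬ p ∣ k), 1 / (k : ℝ)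

/-- One step of the sieve: the multiples of `p` up to `p * X` are `p * l` with `l ≤ X`, and since `p
∉ P` the factor `p` does not affect the sieve by `P`. -/
lemma sievedHarmonic_insert {P : Finset ℕ} {p : ℕ} (hP : ∀ q ∈ P, q.Prime) (hp : p.Prime)
    (hpP : p ∉ P) (X : ℕ) :
    sievedHarmonic (insert p P) (p * X) =
      sievedHarmonic P (p * X) - 1 / (p : ℝ) * sievedHarmonic P X := by
  have hdvd : ∑ k ∈ ((Finset.Ioc 0 (p * X)).filter (fun k => ∀ q ∈ P, ¬ q ∣ k)).filter (p ∣ ·),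
      1 / (k : ℝ) = 1 / (p : ℝ) * sievedHarmonic P X := by
    rw [sievedHarmonic, Finset.mul_sum]
    symm
    refine Finset.sum_bij (fun k _ => p * k) ?_ ?_ ?_ ?_
    · intro k hk
      simp only [Finset.mem_filter, Finset.mem_Ioc] at hk ⊢
      refine ⟨⟨⟨Nat.mul_pos hp.pos hk.1.1, Nat.mul_le_mul_left p hk.1.2⟩, ?_⟩, dvd_mul_right _ _⟩
      intro q hq hqk
      rcases (hP q hq).dvd_mul.1 hqk with h | h
      · rw [(Nat.prime_dvd_prime_iff_eq (hP q hq) hp).1 h] at hq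
        exact hpP hq
      · exact hk.2 q hq h
    · intro a _ b _ hab
      exact Nat.eq_of_mul_eq_mul_left hp.pos hab
    · intro k hk
      simp only [Finset.mem_filter, Finset.mem_Ioc] at hk
      obtain ⟨⟨⟨hk0, hkX⟩, hkP⟩, l, rfl⟩ := hk
      refine ⟨l, ?_, rfl⟩
      simp only [Finset.mem_filter, Finset.mem_Ioc]
      exact ⟨⟨Nat.pos_of_mul_pos_left hk0, Nat.le_of_mul_le_mul_left hkX hp.pos⟩,
        fun q hq hql => hkP q hq (hql.mul_left p)⟩
    · intro k _
      push_cast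
      rw [one_div_mul_one_div]
  rw [← hdvd, eq_sub_iff_add_eq, sievedHarmonic, sievedHarmonic]
  refine Eq.trans ?_ (Finset.sum_filter_not_add_sum_filter _ (p ∣ ·) _)
  congr 2
  ext k
  simp only [Finset.mem_filter, Finset.mem_insert, forall_eq_or_imp]
  tauto

lemma sievedHarmonic_empty (X : ℕ) : sievedHarmonic ∅ X = (harmonic X : ℝ) := by
  rw [sievedHarmonic, harmonic_eq_sum_Icc]
  simp [← Finset.Icc_add_one_left_eq_Ioc]

/-- Induction on `P` from `harmonic m - log m → γ`. All admissible `D` are treated at once because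
sieving by `p` at `D = p * E` uses both `p * E` and `E`. The constants combine through `log (pE) -
(1/p) log E = (1 - 1/p) (log (pE) + log p / (p - 1))`. -/
lemma tendsto_sievedHarmonic_sub (P : Finset ℕ) (hP : ∀ p ∈ P, p.Prime) :
    ∀ D : ℕ, 0 < D → (∏ p ∈ P, p) ∣ D →
    Tendsto (fun m : ℕ => sievedHarmonic P (D * m) -
        (∏ p ∈ P, (1 - 1 / (p : ℝ))) * (harmonic m : ℝ)) atTop
      (𝓝 ((∏ p ∈ P, (1 - 1 / (p : ℝ))) *
        (Real.log D + ∑ p ∈ P, Real.log p / ((p : ℝ) - 1)))) := by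
  induction P using Finset.induction_on with
  | empty =>
    intro D hD _
    have h := Real.tendsto_harmonic_sub_log
    have h1 := h.comp (tendsto_id.const_mul_atTop' hD : Tendsto (fun m : ℕ => D * m) atTop atTop)
    have h2 := (h1.sub h).add_const (Real.log D)
    rw [sub_self, zero_add] at h2
    simp only [Finset.prod_empty, Finset.sum_empty, add_zero, one_mul, sievedHarmonic_empty]
    refine h2.congr' ?_
    filter_upwards [eventually_gt_atTop 0] with m hm
    simp only [Function.comp_apply]
    push_cast
    rw [Real.log_mul (by positivity) (by positivity)]
    ring
  | insert p P hpP ih =>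
    intro D hD hdvd
    have hp : p.Prime := hP p (Finset.mem_insert_self p P)
    have hP' : ∀ q ∈ P, q.Prime := fun q hq => hP q (Finset.mem_insert_of_mem hq)
    rw [Finset.prod_insert hpP] at hdvd
    obtain ⟨E, rfl⟩ := (dvd_mul_right p (∏ q ∈ P, q)).trans hdvd
    have hE : 0 < E := Nat.pos_of_mul_pos_left hD
    have hPE : (∏ q ∈ P, q) ∣ E := Nat.dvd_of_mul_dvd_mul_left hp.pos hdvd
    have h1 := ih hP' (p * E) hD (hPE.mul_left p)
    have h2 := (ih hP' E hE hPE).const_mul (1 / (p : ℝ))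
    have hp1 : (1 : ℝ) < p := by exact_mod_cast hp.one_lt
    have hp1' : (p : ℝ) - 1 ≠ 0 := by linarith
    have hp0 : (p : ℝ) ≠ 0 := by linarith
    convert h1.sub h2 using 1
    · ext m
      rw [mul_assoc p E m, sievedHarmonic_insert hP' hp hpP, Finset.prod_insert hpP]
      ring
    · congr 1
      rw [Finset.prod_insert hpP, Finset.sum_insert hpP]
      push_cast
      rw [Real.log_mul hp0 (by positivity)]
      field_simp
      ring

lemma card_residues (N : ℕ) (hN : 2 ≤ N) : (residues N).card = N.totient := by
  rw [Nat.totient_eq_card_lt_and_coprime, ← Nat.card_eq_finsetCard]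
  refine Nat.card_congr (Equiv.subtypeEquivRight fun r => ?_)
  simp only [residues, Finset.mem_filter, Finset.mem_Icc]
  constructor
  · rintro ⟨⟨_, h2⟩, h3⟩
    refine ⟨lt_of_le_of_ne h2 ?_, h3.symm⟩
    rintro rfl
    simp at h3
    omega
  · rintro ⟨h1, h2⟩
    refine ⟨⟨Nat.pos_of_ne_zero ?_, h1.le⟩, h2.symm⟩
    rintro rfl
    simp at h2
    omega

lemma harm_one (m : ℕ) : harm 1 m = (harmonic m : ℝ) := by
  simp [harm, harmonic, add_comm]

lemma coprime_iff_forall_primeFactors {N : ℕ} (hN : 0 < N) (r : ℕ) :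
    Nat.Coprime r N ↔ ∀ p ∈ N.primeFactors, ¬ p ∣ r := by
  constructor
  · intro h p hp hpr
    exact Nat.not_coprime_of_dvd_of_dvd (Nat.prime_of_mem_primeFactors hp).one_lt hpr
      (Nat.dvd_of_mem_primeFactors hp) h
  · intro h
    refine Nat.coprime_of_dvd fun p hp hpr hpN => h p ?_ hpr
    exact Nat.mem_primeFactors.2 ⟨hp, hpN, hN.ne'⟩

/-- `1 / (r/N + n) = N / (r + n * N)`, and the numbers `r + n * N` with `n < m` run once through the
integers up to `N * m` coprime to `N`. -/
lemma sum_harm_residues {N : ℕ} (hN : 0 < N) (m : ℕ) :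
    ∑ r ∈ residues N, harm ((r : ℝ) / N) m = N * sievedHarmonic N.primeFactors (N * m) := by
  have hset : ∀ X, (Finset.Ioc 0 X).filter (fun k => ∀ p ∈ N.primeFactors, ¬ p ∣ k) =
      (Finset.Ioc 0 X).filter (fun k => Nat.Coprime k N) := fun X =>
    Finset.filter_congr fun k _ => (coprime_iff_forall_primeFactors hN k).symm
  have hN0 : (N : ℝ) ≠ 0 := by positivity
  rw [sievedHarmonic, hset]
  induction m with
  | zero => simp [harm]
  | succ m ih =>
    simp only [harm, Finset.sum_range_succ, Finset.sum_add_distrib] at ih ⊢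
    rw [ih]
    have hsplit : (Finset.Ioc 0 (N * (m + 1))).filter (fun k => Nat.Coprime k N) =
        (Finset.Ioc 0 (N * m)).filter (fun k => Nat.Coprime k N) ∪
          (residues N).image (fun r => N * m + r) := by
      ext k
      simp only [Finset.mem_filter, Finset.mem_Ioc, Finset.mem_union, Finset.mem_image, residues,
        Finset.mem_Icc]
      constructor
      · rintro ⟨⟨h1, h2⟩, h3⟩
        by_cases h : k ≤ N * m
        · exact Or.inl ⟨⟨h1, h⟩, h3⟩
        · obtain ⟨r, rfl⟩ := Nat.exists_eq_add_of_lt (not_le.1 h)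
          refine Or.inr ⟨r + 1, ⟨⟨by omega, ?_⟩, ?_⟩, by ring⟩
          · rw [mul_add] at h2; omega
          · rwa [add_assoc, Nat.coprime_mul_left_add_left] at h3
      · rintro (⟨⟨h1, h2⟩, h3⟩ | ⟨r, ⟨⟨h1, h2⟩, h3⟩, rfl⟩)
        · exact ⟨⟨h1, by rw [mul_add]; omega⟩, h3⟩
        · refine ⟨⟨by omega, by rw [mul_add]; omega⟩, ?_⟩
          rwa [Nat.coprime_mul_left_add_left]
    rw [hsplit, Finset.sum_union, Finset.sum_image (fun a _ b _ h => by simpa using h), mul_add,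
      Finset.mul_sum (residues N)]
    · congr 1
      refine Finset.sum_congr rfl fun r hr => ?_
      have hr1 : 1 ≤ r := by
        simp only [residues, Finset.mem_filter, Finset.mem_Icc] at hr
        exact hr.1.1
      push_cast
      have : (0 : ℝ) < r := by exact_mod_cast hr1
      field_simp
      ring
    · rw [Finset.disjoint_left]
      intro k hk hk'
      simp only [Finset.mem_filter, Finset.mem_Ioc, Finset.mem_image, residues,
        Finset.mem_Icc] at hk hk'
      obtain ⟨r, hr, rfl⟩ := hk'
      omega

lemma totient_eq_mul_prod (N : ℕ) :
    (N.totient : ℝ) = N * ∏ p ∈ N.primeFactors, (1 - 1 / (p : ℝ)) := by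
  have h := congrArg (fun x : ℚ => (x : ℝ)) (Nat.totient_eq_mul_prod_factors N)
  simpa using h

lemma log_C₁ {N : ℕ} (hN : 0 < N) :
    Real.log (C₁ N) =
      N.totient * (Real.log N + ∑ p ∈ N.primeFactors, Real.log p / ((p : ℝ) - 1)) := by
  have hpos : ∀ p ∈ N.primeFactors, (p : ℝ) ^ (N.totient / (p - 1)) ≠ 0 := fun p hp =>
    pow_ne_zero _ (by exact_mod_cast (Nat.prime_of_mem_primeFactors hp).ne_zero)
  rw [C₁]
  push_cast
  rw [Real.log_mul (by positivity) (Finset.prod_ne_zero_iff.2 hpos), Real.log_prod hpos,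
    Real.log_pow, mul_add, Finset.mul_sum]
  congr 1
  refine Finset.sum_congr rfl fun p hp => ?_
  have hpp := Nat.prime_of_mem_primeFactors hp
  have hdvd : p - 1 ∣ N.totient := by
    rw [← Nat.totient_prime hpp]
    exact Nat.totient_dvd_of_dvd (Nat.dvd_of_mem_primeFactors hp)
  have hp1 : (1 : ℝ) < p := by exact_mod_cast hpp.one_lt
  rw [Real.log_pow, Nat.cast_div hdvd (by rw [Nat.cast_sub hpp.one_le]; push_cast; linarith),
    Nat.cast_sub hpp.one_le]
  push_cast
  ring

lemma tendsto_H₁ {N : ℕ} (hN : 0 < N) :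
    Tendsto (H₁ N) atTop (𝓝 (Real.log (C₁ N))) := by
  have h := (tendsto_sievedHarmonic_sub N.primeFactors
    (fun p hp => Nat.prime_of_mem_primeFactors hp) N hN (Nat.prod_primeFactors_dvd N)).const_mul
      (N : ℝ)
  rw [← mul_assoc, ← totient_eq_mul_prod, ← log_C₁ hN] at h
  refine h.congr fun m => ?_
  rw [H₁, sum_harm_residues hN, harm_one, totient_eq_mul_prod]
  ring

lemma residue_div_mem {N r : ℕ} (hr : r ∈ residues N) :
    0 < (r : ℝ) / N ∧ (r : ℝ) / N ≤ 1 := by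
  simp only [residues, Finset.mem_filter, Finset.mem_Icc] at hr
  have h1 : (0 : ℝ) < r := by exact_mod_cast hr.1.1
  have h2 : (r : ℝ) ≤ N := by exact_mod_cast hr.1.2
  exact ⟨div_pos h1 (h1.trans_le h2), div_le_one_of_le₀ h2 (h1.le.trans h2)⟩

/-- Each of the `φ(N)` new terms `1 / (r/N + m)` is at least `1 / (1 + m)`, as `r/N ≤ 1`. -/
lemma monotone_H₁ {N : ℕ} (hN : 2 ≤ N) : Monotone (H₁ N) := by
  refine monotone_nat_of_le_succ fun m => ?_
  simp only [H₁, harm, Finset.sum_range_succ, Finset.sum_add_distrib]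
  have : (N.totient : ℝ) * (1 / (1 + (m : ℝ))) ≤
      ∑ r ∈ residues N, 1 / ((r : ℝ) / N + m) := by
    rw [← card_residues N hN, ← nsmul_eq_mul]
    refine Finset.card_nsmul_le_sum _ _ _ fun r hr => ?_
    obtain ⟨h1, h2⟩ := residue_div_mem hr
    gcongr
  linarith

lemma H₁_zero (N : ℕ) : H₁ N 0 = 0 := by simp [H₁, harm]

lemma H₁_nonneg {N : ℕ} (hN : 2 ≤ N) (m : ℕ) : 0 ≤ H₁ N m :=
  H₁_zero N ▸ monotone_H₁ hN (Nat.zero_le m)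

lemma H₁_le_log_C₁ {N : ℕ} (hN : 2 ≤ N) (m : ℕ) : H₁ N m ≤ Real.log (C₁ N) :=
  (monotone_H₁ hN).ge_of_tendsto (tendsto_H₁ (by omega)) m

/-! ### Lower bounds for `log C_N` -/

/-- The prime `2` contributes `2`, and each odd number from `3` on at most `3/2`, whether prime or
not. -/
lemma sum_prime_div_pred_le (n : ℕ) (hn : 1 ≤ n) :
    ∑ p ∈ (Finset.range (2 * n + 1)).filter Nat.Prime, (p : ℝ) / ((p : ℝ) - 1) ≤
      (3 * n + 1) / 2 := by
  induction n, hn using Nat.le_induction with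
  | base =>
    have : (Finset.range (2 * 1 + 1)).filter Nat.Prime = {2} := by decide
    rw [this]
    norm_num
  | succ n hn ih =>
    have hset : (Finset.range (2 * (n + 1) + 1)).filter Nat.Prime ⊆
        insert (2 * n + 1) ((Finset.range (2 * n + 1)).filter Nat.Prime) := by
      intro p hp
      simp only [Finset.mem_filter, Finset.mem_range, Finset.mem_insert] at hp ⊢
      by_cases h : p < 2 * n + 1
      · exact Or.inr ⟨h, hp.2⟩
      · left
        rcases hp.2.eq_two_or_odd with h2 | h2 <;> omega
    have hn' : (1 : ℝ) ≤ n := by exact_mod_cast hn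
    refine (Finset.sum_le_sum_of_subset_of_nonneg hset fun p hp _ => ?_).trans ?_
    · simp only [Finset.mem_filter, Finset.mem_range, Finset.mem_insert] at hp
      have : (1 : ℝ) ≤ p := by
        rcases hp with rfl | h
        · push_cast; linarith
        · exact_mod_cast h.2.one_le
      exact div_nonneg (by linarith) (by linarith)
    · rw [Finset.sum_insert (by simp)]
      have : ((2 * n + 1 : ℕ) : ℝ) / (((2 * n + 1 : ℕ) : ℝ) - 1) ≤ 3 / 2 := by
        push_cast
        rw [div_le_div_iff₀ (by linarith) (by norm_num)]
        linarith
      push_cast at this ⊢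
      linarith

/-- The value of `log C_n / n` at the squarefree number `n` whose set of prime factors is `P`. -/
noncomputable def radicalLogC (P : Finset ℕ) : ℝ :=
  (∏ p ∈ P, (1 - 1 / (p : ℝ))) * ∑ p ∈ P, (p : ℝ) / ((p : ℝ) - 1) * Real.log p

lemma prod_one_sub_inv_nonneg {P : Finset ℕ} (hP : ∀ p ∈ P, p.Prime) :
    0 ≤ ∏ p ∈ P, (1 - 1 / (p : ℝ)) := by
  refine Finset.prod_nonneg fun p hp => ?_
  have : (1 : ℝ) ≤ p := by exact_mod_cast (hP p hp).one_le
  rw [sub_nonneg, div_le_one₀ (by linarith)]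
  exact this

lemma radicalLogC_insert {P : Finset ℕ} {q : ℕ} (hq : q.Prime) (hqP : q ∉ P) :
    radicalLogC (insert q P) =
      (1 - 1 / (q : ℝ)) * radicalLogC P + (∏ p ∈ P, (1 - 1 / (p : ℝ))) * Real.log q := by
  have hq1 : (1 : ℝ) < q := by exact_mod_cast hq.one_lt
  have : (q : ℝ) - 1 ≠ 0 := by linarith
  rw [radicalLogC, radicalLogC, Finset.prod_insert hqP, Finset.sum_insert hqP]
  field_simp
  ring

/-- The increment has the sign of `q log q - ∑ p/(p-1) log p`, and the crude bound on `∑ p/(p-1)`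
over primes below `q` keeps this nonnegative. -/
lemma radicalLogC_le_insert {P : Finset ℕ} {q : ℕ} (hP : ∀ p ∈ P, p.Prime) (hq : q.Prime)
    (hq2 : q ≠ 2) (hlt : ∀ p ∈ P, p < q) : radicalLogC P ≤ radicalLogC (insert q P) := by
  have hqP : q ∉ P := fun h => lt_irrefl _ (hlt q h)
  have hq1 : (1 : ℝ) < q := by exact_mod_cast hq.one_lt
  have hlog : 0 < Real.log q := Real.log_pos hq1
  have hsum : ∑ p ∈ P, (p : ℝ) / ((p : ℝ) - 1) * Real.log p ≤ q * Real.log q := by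
    obtain ⟨n, hn⟩ := hq.odd_of_ne_two hq2
    have hn1 : 1 ≤ n := by have := hq.two_le; omega
    have hfac : ∀ p : ℕ, p.Prime → 0 ≤ (p : ℝ) / ((p : ℝ) - 1) := fun p hp => by
      have : (1 : ℝ) ≤ p := by exact_mod_cast hp.one_le
      exact div_nonneg (by linarith) (by linarith)
    calc ∑ p ∈ P, (p : ℝ) / ((p : ℝ) - 1) * Real.log p
        ≤ ∑ p ∈ P, (p : ℝ) / ((p : ℝ) - 1) * Real.log q := by
          refine Finset.sum_le_sum fun p hp => mul_le_mul_of_nonneg_left ?_ (hfac p (hP p hp))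
          exact Real.log_le_log (by exact_mod_cast (hP p hp).pos) (by exact_mod_cast (hlt p hp).le)
      _ = (∑ p ∈ P, (p : ℝ) / ((p : ℝ) - 1)) * Real.log q := by rw [Finset.sum_mul]
      _ ≤ q * Real.log q := by
          refine mul_le_mul_of_nonneg_right ?_ hlog.le
          have hsub : P ⊆ (Finset.range (2 * n + 1)).filter Nat.Prime := fun p hp => by
            simp only [Finset.mem_filter, Finset.mem_range]
            exact ⟨hn ▸ hlt p hp, hP p hp⟩
          refine (Finset.sum_le_sum_of_subset_of_nonneg hsub fun p hp _ =>
            hfac p (Finset.mem_filter.1 hp).2).trans ((sum_prime_div_pred_le n hn1).trans ?_)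
          have : (1 : ℝ) ≤ n := by exact_mod_cast hn1
          rw [hn]
          push_cast
          linarith
  have h := mul_le_mul_of_nonneg_left hsum (prod_one_sub_inv_nonneg hP)
  rw [radicalLogC_insert hq hqP]
  change radicalLogC P ≤ _ at h
  have h2 : radicalLogC P / q ≤ (∏ p ∈ P, (1 - 1 / (p : ℝ))) * Real.log q := by
    rw [div_le_iff₀ (by linarith)]
    linarith
  have h3 : (1 - 1 / (q : ℝ)) * radicalLogC P = radicalLogC P - radicalLogC P / q := by ring
  linarith

lemma radicalLogC_nonneg {P : Finset ℕ} (hP : ∀ p ∈ P, p.Prime) : 0 ≤ radicalLogC P := by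
  refine mul_nonneg (prod_one_sub_inv_nonneg hP) (Finset.sum_nonneg fun p hp => ?_)
  have : (1 : ℝ) ≤ p := by exact_mod_cast (hP p hp).one_le
  exact mul_nonneg (div_nonneg (by linarith) (by linarith)) (Real.log_nonneg this)

/-- Primes are adjoined in increasing order: the first one, at least `5`, yields the bound, and
later ones do not decrease the value. -/
lemma le_radicalLogC_union {P : Finset ℕ} (hP : ∀ p ∈ P, p.Prime) (hP5 : ∀ p ∈ P, p < 5)
    (Q : Finset ℕ) (hQ : ∀ p ∈ Q, p.Prime) (hQ5 : ∀ p ∈ Q, 5 ≤ p) (hne : Q.Nonempty) :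
    4 / 5 * radicalLogC P + (∏ p ∈ P, (1 - 1 / (p : ℝ))) * Real.log 5 ≤
      radicalLogC (P ∪ Q) := by
  induction Q using Finset.induction_on_max with
  | empty => simp at hne
  | insert q Q hlt ih =>
    have hq := hQ q (Finset.mem_insert_self q Q)
    have hq5 := hQ5 q (Finset.mem_insert_self q Q)
    have hq5' : (5 : ℝ) ≤ q := by exact_mod_cast hq5
    have hQ' : ∀ p ∈ Q, p.Prime := fun p hp => hQ p (Finset.mem_insert_of_mem hp)
    rcases Q.eq_empty_or_nonempty with rfl | hQne
    · have hqP : q ∉ P := fun h => absurd (hP5 q h) (by omega)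
      rw [Finset.union_insert, Finset.union_empty, radicalLogC_insert hq hqP]
      refine add_le_add (mul_le_mul_of_nonneg_right ?_ (radicalLogC_nonneg hP))
        (mul_le_mul_of_nonneg_left (Real.log_le_log (by norm_num) hq5')
          (prod_one_sub_inv_nonneg hP))
      have : 1 / (q : ℝ) ≤ 1 / 5 := one_div_le_one_div_of_le (by norm_num) hq5'
      linarith
    · refine (ih hQ' (fun p hp => hQ5 p (Finset.mem_insert_of_mem hp)) hQne).trans ?_
      rw [Finset.union_insert]
      refine radicalLogC_le_insert ?_ hq (by omega) ?_
      · intro p hp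
        rcases Finset.mem_union.1 hp with h | h
        exacts [hP p h, hQ' p h]
      · intro p hp
        rcases Finset.mem_union.1 hp with h | h
        exacts [(hP5 p h).trans_le hq5, hlt p h]

/-- `N` is at least its radical, so `log N ≥ ∑ log p`; then `1 + 1/(p-1) = p/(p-1)`. -/
lemma mul_radicalLogC_le_log_C₁ {N : ℕ} (hN : 0 < N) :
    N * radicalLogC N.primeFactors ≤ Real.log (C₁ N) := by
  rw [log_C₁ hN, totient_eq_mul_prod, radicalLogC, mul_assoc]
  refine mul_le_mul_of_nonneg_left (mul_le_mul_of_nonneg_left ?_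
    (prod_one_sub_inv_nonneg fun p hp => Nat.prime_of_mem_primeFactors hp)) (by positivity)
  have hrad : ∑ p ∈ N.primeFactors, Real.log p ≤ Real.log N := by
    rw [← Real.log_prod fun p hp => by exact_mod_cast (Nat.prime_of_mem_primeFactors hp).ne_zero,
      ← Nat.cast_prod]
    have h0 : 0 < ∏ p ∈ N.primeFactors, p :=
      Finset.prod_pos fun p hp => (Nat.prime_of_mem_primeFactors hp).pos
    have hle := Nat.le_of_dvd hN (Nat.prod_primeFactors_dvd N)
    exact Real.log_le_log (by exact_mod_cast h0) (by exact_mod_cast hle)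
  have hsplit : ∀ p ∈ N.primeFactors, (p : ℝ) / ((p : ℝ) - 1) * Real.log p =
      Real.log p + Real.log p / ((p : ℝ) - 1) := fun p hp => by
    have : (1 : ℝ) < p := by exact_mod_cast (Nat.prime_of_mem_primeFactors hp).one_lt
    have : (p : ℝ) - 1 ≠ 0 := by linarith
    field_simp
    ring
  rw [Finset.sum_congr rfl hsplit, Finset.sum_add_distrib]
  linarith

lemma log_three_gt : 1.09 < Real.log 3 := by
  rw [Real.lt_log_iff_exp_lt (by norm_num)]
  have h := Real.exp_one_lt_d9
  -- Reduces to `e ^ 109 < 3 ^ 100`.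
  have h100 : Real.exp 1.09 ^ 100 < 3 ^ 100 := by
    rw [← Real.exp_nat_mul, show ((100 : ℕ) : ℝ) * 1.09 = (109 : ℕ) * 1 by norm_num,
      Real.exp_nat_mul]
    exact (pow_lt_pow_left₀ h (Real.exp_pos 1).le (by norm_num)).trans (by norm_num)
  exact lt_of_pow_lt_pow_left₀ 100 (by norm_num) h100

lemma log_five_gt : 1.6 < Real.log 5 := by
  rw [Real.lt_log_iff_exp_lt (by norm_num)]
  have h := Real.exp_one_lt_d9
  have h5 : Real.exp 1.6 ^ 5 < 5 ^ 5 := by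
    rw [← Real.exp_nat_mul, show ((5 : ℕ) : ℝ) * 1.6 = (8 : ℕ) * 1 by norm_num,
      Real.exp_nat_mul]
    exact (pow_lt_pow_left₀ h (Real.exp_pos 1).le (by norm_num)).trans (by norm_num)
  exact lt_of_pow_lt_pow_left₀ 5 (by norm_num) h5

/-- The bound fails for `N = 2, 3, 4, 6`. A prime factor `≥ 5` allows reduction to the radical;
otherwise the size of `N` itself must be used. -/
lemma six_fifths_mul_le_log_C₁ {N : ℕ} (hN : 5 ≤ N) (hN6 : N ≠ 6) :
    6 / 5 * (N : ℝ) ≤ Real.log (C₁ N) := by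
  have hN0 : 0 < N := by omega
  have l2 := Real.log_two_gt_d9
  have l3 := log_three_gt
  have l5 := log_five_gt
  set P := N.primeFactors.filter (· < 5) with hPdef
  set Q := N.primeFactors.filter (¬ · < 5) with hQdef
  have hPQ : P ∪ Q = N.primeFactors := Finset.filter_union_filter_not_eq _ _
  have hprime : ∀ p ∈ N.primeFactors, p.Prime := fun p hp => Nat.prime_of_mem_primeFactors hp
  have hP : ∀ p ∈ P, p.Prime := fun p hp => hprime p (Finset.mem_filter.1 hp).1
  have hP5 : ∀ p ∈ P, p < 5 := fun p hp => (Finset.mem_filter.1 hp).2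
  have hPcases : P = ∅ ∨ P = {2} ∨ P = {3} ∨ P = {2, 3} := by
    have hsub : P ⊆ {2, 3} := fun p hp => by
      have h1 := hP p hp
      have h2 := hP5 p hp
      interval_cases p <;> revert h1 <;> decide
    have : P ∈ ({2, 3} : Finset ℕ).powerset := Finset.mem_powerset.2 hsub
    rw [show ({2, 3} : Finset ℕ).powerset = {∅, {2}, {3}, {2, 3}} by decide] at this
    simpa using this
  rcases Q.eq_empty_or_nonempty with hQ | hQ
  · rw [hQ, Finset.union_empty] at hPQ
    rw [log_C₁ hN0, totient_eq_mul_prod, ← hPQ, mul_comm (6 / 5 : ℝ), mul_assoc]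
    refine mul_le_mul_of_nonneg_left ?_ (by positivity)
    have hdvd := Nat.prod_primeFactors_dvd N
    rw [← hPQ] at hdvd
    -- The smallest admissible `N` with these prime factors are `8`, `9` and `12`.
    rcases hPcases with h | h | h | h
    · rw [h] at hPQ
      rcases Nat.primeFactors_eq_empty.1 hPQ.symm with h | h <;> omega
    · have h8 : 8 ≤ N := by
        have h3 : ¬ 3 ∣ N := fun h' => by
          have : 3 ∈ N.primeFactors := Nat.mem_primeFactors.2 ⟨by norm_num, h', by omega⟩
          rw [← hPQ, h] at this
          simp at this
        have h5 : ¬ 5 ∣ N := fun h' => by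
          have : 5 ∈ N.primeFactors := Nat.mem_primeFactors.2 ⟨by norm_num, h', by omega⟩
          rw [← hPQ, h] at this
          simp at this
        rw [h] at hdvd
        simp at hdvd
        omega
      have hlog : Real.log (2 ^ 3) ≤ Real.log N :=
        Real.log_le_log (by norm_num) (by exact_mod_cast h8)
      rw [Real.log_pow] at hlog
      rw [h]
      norm_num at hlog ⊢
      linarith
    · have h9 : 9 ≤ N := by
        have h3 : ¬ 2 ∣ N := fun h' => by
          have : 2 ∈ N.primeFactors := Nat.mem_primeFactors.2 ⟨by norm_num, h', by omega⟩
          rw [← hPQ, h] at this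
          simp at this
        rw [h] at hdvd
        simp at hdvd
        omega
      have hlog : Real.log (3 ^ 2) ≤ Real.log N :=
        Real.log_le_log (by norm_num) (by exact_mod_cast h9)
      rw [Real.log_pow] at hlog
      rw [h]
      norm_num at hlog ⊢
      linarith
    · have h12 : 12 ≤ N := by
        rw [h] at hdvd
        simp at hdvd
        omega
      have hlog : Real.log (2 ^ 2 * 3) ≤ Real.log N :=
        Real.log_le_log (by norm_num) (by norm_num; exact_mod_cast h12)
      rw [Real.log_mul (by norm_num) (by norm_num), Real.log_pow] at hlog
      rw [h, Finset.prod_pair (by norm_num), Finset.sum_pair (by norm_num)]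
      norm_num at hlog ⊢
      linarith
  · refine le_trans ?_ (mul_radicalLogC_le_log_C₁ hN0)
    rw [mul_comm]
    refine mul_le_mul_of_nonneg_left ?_ (by positivity)
    rw [← hPQ]
    refine le_trans ?_ (le_radicalLogC_union hP hP5 Q
      (fun p hp => hprime p (Finset.mem_filter.1 hp).1)
      (fun p hp => not_lt.1 (Finset.mem_filter.1 hp).2) hQ)
    rcases hPcases with h | h | h | h <;> rw [h]
    · simp only [radicalLogC, Finset.prod_empty, Finset.sum_empty]
      linarith
    · simp only [radicalLogC, Finset.prod_singleton, Finset.sum_singleton]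
      norm_num
      linarith
    · simp only [radicalLogC, Finset.prod_singleton, Finset.sum_singleton]
      norm_num
      linarith
    · rw [radicalLogC, Finset.prod_pair (by norm_num), Finset.sum_pair (by norm_num)]
      norm_num
      linarith

/-- Equality holds at `N = 2`; for `N ≥ 4` the term `log N` alone suffices. -/
lemma totient_mul_log_four_le_log_C₁ {N : ℕ} (hN : 2 ≤ N) :
    N.totient * Real.log 4 ≤ Real.log (C₁ N) := by
  rw [log_C₁ (by omega)]
  refine mul_le_mul_of_nonneg_left ?_ (by positivity)
  have hterm : ∀ p ∈ N.primeFactors, 0 ≤ Real.log p / ((p : ℝ) - 1) := fun p hp => by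
    have : (1 : ℝ) ≤ p := by exact_mod_cast (Nat.prime_of_mem_primeFactors hp).one_le
    exact div_nonneg (Real.log_nonneg this) (by linarith)
  have l2 := Real.log_two_lt_d9
  have l3 := log_three_gt
  have l4 : Real.log 4 = 2 * Real.log 2 := by
    rw [show (4 : ℝ) = 2 ^ 2 by norm_num, Real.log_pow]
    norm_num
  rcases Nat.lt_or_ge N 4 with h | h
  · interval_cases N
    · rw [Nat.prime_two.primeFactors]
      norm_num
      linarith
    · rw [Nat.prime_three.primeFactors]
      norm_num
      linarith
  · have := Finset.sum_nonneg hterm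
    have : Real.log 4 ≤ Real.log N := Real.log_le_log (by norm_num) (by exact_mod_cast h)
    linarith

lemma C₁_pos {N : ℕ} (hN : 0 < N) : 0 < C₁ N :=
  Nat.mul_pos (Nat.pow_pos hN)
    (Finset.prod_pos fun _ hp => Nat.pow_pos (Nat.prime_of_mem_primeFactors hp).pos)

/-- A maximal `N i` suffices alone unless it is `6` or at most `4`. In those cases `Φ ≥ 4` helps,
each unit of `Φ` being worth `log 4`: `4 log 4 > 24/5`, and `log C_6 + 2 log 4 > 36/5`. -/
lemma six_fifths_mul_M_le_log_C {k : ℕ} (N : Fin k → ℕ) (hN : ∀ j, 2 ≤ N j)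
    (hPhi : 4 ≤ Phi N) : 6 / 5 * (M N : ℝ) ≤ Real.log (C N) := by
  have hk : (Finset.univ : Finset (Fin k)).Nonempty := by
    by_contra h
    rw [Finset.not_nonempty_iff_eq_empty] at h
    simp [Phi, h] at hPhi
  obtain ⟨i, -, hi⟩ := Finset.exists_mem_eq_sup _ hk N
  have hlogC : Real.log (C N) = ∑ j, Real.log (C₁ (N j)) := by
    rw [C]
    push_cast
    rw [Real.log_prod fun j _ => by
      exact_mod_cast (C₁_pos (show 0 < N j by have := hN j; omega)).ne']
  have hsum : ((Phi N : ℝ) - (N i).totient) * Real.log 4 + Real.log (C₁ (N i)) ≤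
      Real.log (C N) := by
    rw [hlogC, Phi, ← Finset.add_sum_erase _ _ (Finset.mem_univ i),
      ← Finset.add_sum_erase _ _ (Finset.mem_univ i)]
    push_cast
    have : ∑ j ∈ Finset.univ.erase i, ((N j).totient : ℝ) * Real.log 4 ≤
        ∑ j ∈ Finset.univ.erase i, Real.log (C₁ (N j)) :=
      Finset.sum_le_sum fun j _ => totient_mul_log_four_le_log_C₁ (hN j)
    rw [← Finset.sum_mul] at this
    linarith
  have hphile : ((N i).totient : ℝ) ≤ Phi N := by
    exact_mod_cast Finset.single_le_sum (f := fun j => (N j).totient) (fun _ _ => Nat.zero_le _)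
      (Finset.mem_univ i)
  have hPhi' : (4 : ℝ) ≤ Phi N := by exact_mod_cast hPhi
  have l4 : Real.log 4 = 2 * Real.log 2 := by
    rw [show (4 : ℝ) = 2 ^ 2 by norm_num, Real.log_pow]
    norm_num
  have l2 := Real.log_two_gt_d9
  have l3 := log_three_gt
  have h4 := totient_mul_log_four_le_log_C₁ (hN i)
  have hMi : M N = N i := hi
  have h2i := hN i
  rw [hMi]
  by_cases h6 : N i = 6
  · have hl6 := log_C₁ (show 0 < N i by omega)
    have ht : (6 : ℕ).totient = 2 := by decide
    have hpf : (6 : ℕ).primeFactors = {2, 3} := by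
      rw [show 6 = 2 * 3 from rfl, Nat.primeFactors_mul (by norm_num) (by norm_num),
        Nat.prime_two.primeFactors, Nat.prime_three.primeFactors]
      rfl
    rw [h6] at hsum hphile
    rw [h6, hpf, Finset.sum_pair (by norm_num), ht] at hl6
    have : Real.log ((6 : ℕ) : ℝ) = Real.log 2 + Real.log 3 := by
      rw [← Real.log_mul (by norm_num) (by norm_num)]
      norm_num
    rw [this] at hl6
    rw [h6]
    rw [ht] at hsum
    have : 2 * Real.log 4 ≤ ((Phi N : ℝ) - (2 : ℕ)) * Real.log 4 :=
      mul_le_mul_of_nonneg_right (by push_cast; linarith) (by linarith)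
    norm_num at hl6 hsum this ⊢
    linarith
  · rcases Nat.lt_or_ge (N i) 5 with h5 | h5
    · have h5' : (N i : ℝ) ≤ 4 := by exact_mod_cast Nat.le_of_lt_succ h5
      have : 4 * Real.log 4 ≤ (Phi N : ℝ) * Real.log 4 :=
        mul_le_mul_of_nonneg_right hPhi' (by linarith)
      linarith
    · have := six_fifths_mul_le_log_C₁ h5 h6
      have : 0 ≤ ((Phi N : ℝ) - (N i).totient) * Real.log 4 :=
        mul_nonneg (by linarith) (by linarith)
      linarith

/-! ### Bounds for the coefficients `B_𝐍(m) / C_𝐍 ^ m` -/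

/-- `(x)_m / m!`. -/
noncomputable def pochRatio (x : ℝ) (m : ℕ) : ℝ :=
  (ascPochhammer ℝ m).eval x / (Nat.factorial m : ℝ)

lemma pochRatio_zero (x : ℝ) : pochRatio x 0 = 1 := by simp [pochRatio]

lemma pochRatio_succ (x : ℝ) (m : ℕ) :
    pochRatio x (m + 1) = pochRatio x m * ((x + m) / (m + 1)) := by
  rw [pochRatio, pochRatio, ascPochhammer_succ_eval, Nat.factorial_succ, div_mul_div_comm]
  push_cast
  rw [mul_comm ((m : ℝ) + 1)]

lemma pochRatio_pos {x : ℝ} (hx : 0 < x) (m : ℕ) : 0 < pochRatio x m :=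
  div_pos (ascPochhammer_pos m x hx) (by positivity)

/-- Factor by factor, `(x + m) (1 - x + m) ≤ (1/2 + m)²` by AM-GM. -/
lemma pochRatio_mul_one_sub_le {x : ℝ} (h0 : 0 < x) (h1 : x < 1) (m : ℕ) :
    pochRatio x m * pochRatio (1 - x) m ≤ pochRatio (1 / 2) m ^ 2 := by
  induction m with
  | zero => simp [pochRatio_zero]
  | succ m ih =>
    simp only [pochRatio_succ]
    calc pochRatio x m * ((x + m) / (m + 1)) * (pochRatio (1 - x) m * ((1 - x + m) / (m + 1)))
        = pochRatio x m * pochRatio (1 - x) m * ((x + m) * (1 - x + m) / (m + 1) ^ 2) := by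
          field_simp
      _ ≤ pochRatio (1 / 2) m ^ 2 * ((1 / 2 + m) ^ 2 / (m + 1) ^ 2) := by
          have : (0 : ℝ) ≤ 1 - x := by linarith
          refine mul_le_mul ih ?_ (by positivity) (by positivity)
          gcongr
          nlinarith [sq_nonneg (x - 1 / 2)]
      _ = (pochRatio (1 / 2) m * ((1 / 2 + m) / (m + 1))) ^ 2 := by
          field_simp

lemma pochRatio_half_sq_le (m : ℕ) : pochRatio (1 / 2) m ^ 2 ≤ 1 / (3 * m + 1) := by
  induction m with
  | zero => simp [pochRatio_zero]
  | succ m ih =>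
    rw [pochRatio_succ, mul_pow]
    refine (mul_le_mul_of_nonneg_right ih (by positivity)).trans ?_
    push_cast
    rw [div_pow, div_mul_div_comm, div_le_div_iff₀ (by positivity) (by positivity)]
    have : (0 : ℝ) ≤ m := by positivity
    nlinarith

lemma pochRatio_half_le_one (m : ℕ) : pochRatio (1 / 2) m ≤ 1 := by
  have h := pochRatio_half_sq_le m
  have h1 : 1 / (3 * (m : ℝ) + 1) ≤ 1 := by
    rw [div_le_one₀ (by positivity)]
    linarith [show (0 : ℝ) ≤ m by positivity]
  exact (sq_le_one_iff₀ (pochRatio_pos (by norm_num) m).le).1 (h.trans h1)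

lemma residues_lt {N r : ℕ} (hN : 2 ≤ N) (hr : r ∈ residues N) : r < N := by
  simp only [residues, Finset.mem_filter, Finset.mem_Icc] at hr
  refine lt_of_le_of_ne hr.1.2 ?_
  rintro rfl
  have := hr.2
  simp at this
  omega

lemma sub_mem_residues {N r : ℕ} (hN : 2 ≤ N) (hr : r ∈ residues N) : N - r ∈ residues N := by
  have hlt := residues_lt hN hr
  simp only [residues, Finset.mem_filter, Finset.mem_Icc] at hr ⊢
  exact ⟨by omega, (Nat.coprime_self_sub_left hlt.le).2 hr.2⟩

/-- `B_N(m) / C_N ^ m`. -/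
noncomputable def normB₁ (N m : ℕ) : ℝ := ∏ r ∈ residues N, pochRatio ((r : ℝ) / N) m

lemma normB₁_pos (N m : ℕ) : 0 < normB₁ N m :=
  Finset.prod_pos fun _ hr => pochRatio_pos (residue_div_mem hr).1 m

/-- The reflection `r ↦ N - r` permutes the residues. Squaring the product avoids choosing pairs,
and so covers the fixed point at `N = 2`. -/
lemma normB₁_le {N : ℕ} (hN : 2 ≤ N) (m : ℕ) :
    normB₁ N m ≤ pochRatio (1 / 2) m ^ N.totient := by
  have hc := pochRatio_pos (show (0 : ℝ) < 1 / 2 by norm_num) m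
  refine (pow_le_pow_iff_left₀ (normB₁_pos N m).le (by positivity) two_ne_zero).1 ?_
  have hrefl : normB₁ N m = ∏ r ∈ residues N, pochRatio (1 - (r : ℝ) / N) m := by
    refine Finset.prod_bij (fun r _ => N - r) (fun r hr => sub_mem_residues hN hr) ?_ ?_ ?_
    · intro a ha b hb hab
      have := residues_lt hN ha
      have := residues_lt hN hb
      omega
    · intro r hr
      have := residues_lt hN hr
      exact ⟨N - r, sub_mem_residues hN hr, by omega⟩
    · intro r hr
      have hN0 : (N : ℝ) ≠ 0 := by
        have : N ≠ 0 := by omega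
        exact_mod_cast this
      rw [Nat.cast_sub (residues_lt hN hr).le]
      congr 1
      field_simp
      ring
  calc normB₁ N m ^ 2
      = ∏ r ∈ residues N, pochRatio ((r : ℝ) / N) m * pochRatio (1 - (r : ℝ) / N) m := by
        rw [sq]
        nth_rewrite 2 [hrefl]
        rw [normB₁, Finset.prod_mul_distrib]
    _ ≤ ∏ _r ∈ residues N, pochRatio (1 / 2) m ^ 2 := by
        have hlt : ∀ r ∈ residues N, (r : ℝ) / N < 1 := fun r hr => by
          have h := residues_lt hN hr
          rw [div_lt_one (by exact_mod_cast (Nat.zero_le r).trans_lt h)]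
          exact_mod_cast h
        refine Finset.prod_le_prod (fun r hr => ?_) fun r hr =>
          pochRatio_mul_one_sub_le (residue_div_mem hr).1 (hlt r hr) m
        exact (mul_pos (pochRatio_pos (residue_div_mem hr).1 m)
          (pochRatio_pos (sub_pos.2 (hlt r hr)) m)).le
    _ = (pochRatio (1 / 2) m ^ N.totient) ^ 2 := by
        rw [Finset.prod_const, card_residues N hN, pow_right_comm]

/-- `B_𝐍(m) / C_𝐍 ^ m`. -/
noncomputable def normB {k : ℕ} (N : Fin k → ℕ) (m : ℕ) : ℝ := ∏ j, normB₁ (N j) m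

lemma C_pos {k : ℕ} {N : Fin k → ℕ} (hN : ∀ j, 2 ≤ N j) : 0 < C N :=
  Finset.prod_pos fun j _ => C₁_pos ((Nat.zero_lt_two).trans_le (hN j))

lemma B_mul_inv_C_pow {k : ℕ} {N : Fin k → ℕ} (hN : ∀ j, 2 ≤ N j) (m : ℕ) :
    B N m * (1 / (C N : ℝ)) ^ m = normB N m := by
  have hC : (C N : ℝ) ≠ 0 := by exact_mod_cast (C_pos hN).ne'
  have : B N m = (C N : ℝ) ^ m * normB N m := by
    rw [B, normB, C]
    push_cast
    rw [← Finset.prod_pow, ← Finset.prod_mul_distrib]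
    rfl
  rw [this, one_div, inv_pow]
  field_simp

lemma normB_pos {k : ℕ} (N : Fin k → ℕ) (m : ℕ) : 0 < normB N m :=
  Finset.prod_pos fun j _ => normB₁_pos (N j) m

lemma normB_zero {k : ℕ} (N : Fin k → ℕ) : normB N 0 = 1 := by
  simp [normB, normB₁, pochRatio_zero]

lemma normB_le {k : ℕ} {N : Fin k → ℕ} (hN : ∀ j, 2 ≤ N j) (hPhi : 4 ≤ Phi N) (m : ℕ) :
    normB N m ≤ 1 / (3 * m + 1) ^ 2 := by
  have hc := (pochRatio_pos (show (0 : ℝ) < 1 / 2 by norm_num) m).le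
  calc normB N m ≤ ∏ j, pochRatio (1 / 2) m ^ (N j).totient :=
        Finset.prod_le_prod (fun j _ => (normB₁_pos _ _).le) fun j _ => normB₁_le (hN j) m
    _ = pochRatio (1 / 2) m ^ Phi N := by rw [Finset.prod_pow_eq_pow_sum, Phi]
    _ ≤ pochRatio (1 / 2) m ^ 4 := pow_le_pow_of_le_one hc (pochRatio_half_le_one m) hPhi
    _ = (pochRatio (1 / 2) m ^ 2) ^ 2 := by ring
    _ ≤ (1 / (3 * m + 1)) ^ 2 := by
        gcongr
        exact pochRatio_half_sq_le m
    _ = 1 / (3 * m + 1) ^ 2 := by rw [div_pow, one_pow]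

lemma sum_range_normB_succ_le {k : ℕ} {N : Fin k → ℕ} (hN : ∀ j, 2 ≤ N j) (hPhi : 4 ≤ Phi N)
    (n : ℕ) : ∑ m ∈ Finset.range n, normB N (m + 1) ≤ 2 / 15 - 2 / (3 * (6 * n + 5)) := by
  induction n with
  | zero => norm_num
  | succ n ih =>
    rw [Finset.sum_range_succ]
    have h := normB_le hN hPhi (n + 1)
    -- Telescoping from `1/x² ≤ 1/(x² - 9/4)` with `x = 3n + 4`.
    have hstep : 1 / (3 * ((n + 1 : ℕ) : ℝ) + 1) ^ 2 ≤
        2 / (3 * (6 * n + 5)) - 2 / (3 * (6 * ((n + 1 : ℕ) : ℝ) + 5)) := by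
      push_cast
      rw [div_sub_div _ _ (by positivity) (by positivity),
        div_le_div_iff₀ (by positivity) (by positivity)]
      have : (0 : ℝ) ≤ n := by positivity
      nlinarith
    linarith

lemma summable_normB {k : ℕ} {N : Fin k → ℕ} (hN : ∀ j, 2 ≤ N j) (hPhi : 4 ≤ Phi N) :
    Summable (normB N) := by
  rw [← summable_nat_add_iff 1]
  refine summable_of_sum_range_le (c := 2 / 15) (fun m => (normB_pos N _).le) fun n => ?_
  have : (0 : ℝ) ≤ 2 / (3 * (6 * n + 5)) := by positivity
  linarith [sum_range_normB_succ_le hN hPhi n]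

lemma tsum_normB_le {k : ℕ} {N : Fin k → ℕ} (hN : ∀ j, 2 ≤ N j) (hPhi : 4 ≤ Phi N) :
    ∑' m, normB N m ≤ 17 / 15 := by
  rw [(summable_normB hN hPhi).tsum_eq_zero_add, normB_zero]
  have : ∑' m, normB N (m + 1) ≤ 2 / 15 := by
    refine Real.tsum_le_of_sum_range_le (fun m => (normB_pos N _).le) fun n => ?_
    have : (0 : ℝ) ≤ 2 / (3 * (6 * n + 5)) := by positivity
    linarith [sum_range_normB_succ_le hN hPhi n]
  linarith

/-! ### The inequality at the boundary point -/

lemma pi_mul_cot_pi_div_lt {n : ℕ} (hn : 2 ≤ n) : Real.pi * Real.cot (Real.pi / n) < n := by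
  have hn' : (2 : ℝ) ≤ n := by exact_mod_cast hn
  have hpi := Real.pi_pos
  have hx0 : 0 < Real.pi / n := by positivity
  have hx2 : Real.pi / n ≤ Real.pi / 2 := div_le_div_of_nonneg_left hpi.le (by norm_num) hn'
  have hsin : 0 < Real.sin (Real.pi / n) := Real.sin_pos_of_pos_of_lt_pi hx0 (by linarith)
  have hkey : Real.pi / n * Real.cos (Real.pi / n) < Real.sin (Real.pi / n) := by
    rcases hx2.lt_or_eq with h | h
    · have hcos : 0 < Real.cos (Real.pi / n) := Real.cos_pos_of_mem_Ioo ⟨by linarith, h⟩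
      have := Real.lt_tan hx0 h
      rwa [Real.tan_eq_sin_div_cos, lt_div_iff₀ hcos] at this
    -- At `n = 2` the tangent has its default value `0`, so `t < tan t` is unavailable.
    · rw [h, Real.cos_pi_div_two, Real.sin_pi_div_two]
      norm_num
  rw [Real.cot_eq_cos_div_sin, ← mul_div_assoc, div_lt_iff₀ hsin]
  calc Real.pi * Real.cos (Real.pi / n) = n * (Real.pi / n * Real.cos (Real.pi / n)) := by
        field_simp
    _ < n * Real.sin (Real.pi / n) := by gcongr

lemma H_nonneg {k : ℕ} {N : Fin k → ℕ} (hN : ∀ j, 2 ≤ N j) (m : ℕ) : 0 ≤ H N m :=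
  Finset.sum_nonneg fun j _ => H₁_nonneg (hN j) m

lemma H_zero {k : ℕ} (N : Fin k → ℕ) : H N 0 = 0 := by simp [H, H₁_zero]

lemma H_le_log_C {k : ℕ} {N : Fin k → ℕ} (hN : ∀ j, 2 ≤ N j) (m : ℕ) :
    H N m ≤ Real.log (C N) := by
  rw [C]
  push_cast
  rw [Real.log_prod fun j _ => by
    exact_mod_cast (C₁_pos ((Nat.zero_lt_two).trans_le (hN j))).ne']
  exact Finset.sum_le_sum fun j _ => H₁_le_log_C₁ (hN j) m

lemma summable_H_mul_normB {k : ℕ} {N : Fin k → ℕ} (hN : ∀ j, 2 ≤ N j) (hPhi : 4 ≤ Phi N) :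
    Summable fun m => H N m * normB N m :=
  Summable.of_nonneg_of_le (fun m => mul_nonneg (H_nonneg hN m) (normB_pos N m).le)
    (fun m => mul_le_mul_of_nonneg_right (H_le_log_C hN m) (normB_pos N m).le)
    ((summable_normB hN hPhi).mul_left _)

/-- The saving `- 1` comes from `H_𝐍(0) = 0`: the constant term `1` of `F` has no counterpart in
`G`. -/
lemma tsum_H_mul_normB_le {k : ℕ} {N : Fin k → ℕ} (hN : ∀ j, 2 ≤ N j) (hPhi : 4 ≤ Phi N) :
    ∑' m, H N m * normB N m ≤ Real.log (C N) * (∑' m, normB N m - 1) := by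
  have hs := summable_normB hN hPhi
  have hg := summable_H_mul_normB hN hPhi
  have hs' : Summable fun m => Real.log (C N) * normB N (m + 1) :=
    ((summable_nat_add_iff 1).2 hs).mul_left _
  have hg' : Summable fun m => H N (m + 1) * normB N (m + 1) :=
    (summable_nat_add_iff (f := fun m => H N m * normB N m) 1).2 hg
  have hle : ∑' m, H N (m + 1) * normB N (m + 1) ≤ ∑' m, Real.log (C N) * normB N (m + 1) :=
    hg'.tsum_le_tsum (fun m => mul_le_mul_of_nonneg_right (H_le_log_C hN _) (normB_pos N _).le) hs'
  rw [tsum_mul_left] at hle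
  rw [hg.tsum_eq_zero_add, hs.tsum_eq_zero_add, normB_zero, H_zero, zero_mul, zero_add,
    add_sub_cancel_left]
  exact hle

end MirrorMap

/-- The two convergence claims say that the value of `q_𝐍` at the boundary point `1 / C_𝐍` of the
disk of convergence is given by convergent series. -/
theorem lemma9 {k : ℕ} (N : Fin k → ℕ) (hN : ∀ j, 2 ≤ N j) (hPhi : 4 ≤ MirrorMap.Phi N) :
    Summable (fun m : ℕ => MirrorMap.B N m * (1 / (MirrorMap.C N : ℝ)) ^ m) ∧
    Summable (fun m : ℕ =>
      MirrorMap.H N m * MirrorMap.B N m * (1 / (MirrorMap.C N : ℝ)) ^ m) ∧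
    Real.exp (-(Real.pi * Real.cot (Real.pi / (MirrorMap.M N : ℝ)))) >
      MirrorMap.q N (1 / (MirrorMap.C N : ℝ)) := by
  open MirrorMap in
  have hF := summable_normB hN hPhi
  have hG := summable_H_mul_normB hN hPhi
  simp only [q, F, G, mul_assoc (H N _), B_mul_inv_C_pow hN]
  refine ⟨hF, hG, ?_⟩
  have hCpos : (0 : ℝ) < C N := by exact_mod_cast C_pos hN
  have hF1 : 1 ≤ ∑' m, normB N m := by
    rw [← normB_zero N]
    exact hF.le_tsum 0 fun m _ => (normB_pos N m).le
  have hF2 := tsum_normB_le hN hPhi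
  have hGle := tsum_H_mul_normB_le hN hPhi
  have hlog := six_fifths_mul_M_le_log_C N hN hPhi
  have hM : 2 ≤ M N := by
    obtain ⟨j⟩ : Nonempty (Fin k) := by
      by_contra h
      rw [not_nonempty_iff] at h
      simp [Phi] at hPhi
    exact (hN j).trans (Finset.le_sup (Finset.mem_univ j))
  have hM' : (2 : ℝ) ≤ M N := by exact_mod_cast hM
  have hcot := pi_mul_cot_pi_div_lt hM
  have hratio : (∑' m, H N m * normB N m) / ∑' m, normB N m ≤ Real.log (C N) - M N := by
    rw [div_le_iff₀ (by linarith)]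
    -- Clearing denominators leaves `M * F ≤ log C`, which holds since `17/15 < 6/5`.
    have : (M N : ℝ) * ∑' m, normB N m ≤ M N * (17 / 15) :=
      mul_le_mul_of_nonneg_left hF2 (by linarith)
    linarith
  calc 1 / (C N : ℝ) * Real.exp ((∑' m, H N m * normB N m) / ∑' m, normB N m)
      ≤ 1 / (C N : ℝ) * Real.exp (Real.log (C N) - M N) := by gcongr
    _ = Real.exp (-(M N : ℝ)) := by
        rw [sub_eq_add_neg, Real.exp_add, Real.exp_log hCpos]
        field_simp
    _ < _ := Real.exp_lt_exp.2 (by linarith)
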